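/- Let $\mathbb K$ be a field of characteristic zero. Algebras are associative $\mathbb K$-algebras, not necessarily unital nor commutative. A Rota–Baxter (RB) algebra of weight one is an algebra $B$ with a linear map $P:B\to B$ such that $P(x)P(y)=P(P(x)y+xP(y)+xy)$ for all $x,y\in B$; morphisms of RB algebras are the (not necessarily unital) algebra morphisms that commute with the operators. An RB subalgebra is a (not necessarily unital) subalgebra stable under the operator. A weight-one RB algebra $F$ is free on elements $g_1,\dots,g_n\in F$ if for every weight-one RB algebra $B$ and all $b_1,\dots,b_n\in B$ there is a unique RB morphism $F\to B$ with $g_i\mapsto b_i$ for all $i$. Let $T(X)$ be the free associative algebra over the alphabet $X=(x_1,x_2,\dots)$ and, for $n\ge 0$, let $T(X^1,\dots,X^n)$ be the free associative algebra over the disjoint union of the alphabets $X^i=(x^i_1,x^i_2,\dots)$. Let $A$ (resp. $A^{(n)}$) be the algebra of sequences $(y_1,y_2,\dots)$ of elements of $T(X)$ (resp. $T(X^1,\dots,X^n)$) with pointwise operations, equipped with the weight-one RB operator $$R(y_1,y_2,y_3,\dots)=(0,\,y_1,\,y_1+y_2,\,y_1+y_2+y_3,\dots).$$ View $X$ as the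 element $(x_1,x_2,\dots)$ of $A$ and $X^i$ as the element $(x^i_1,x^i_2,\dots)$ of $A^{(n)}$. **Theorem.** The RB subalgebra $\mathcal R$ of $A$ generated by $X$ is a free weight-one RB algebra on the one generator $X$. More generally, for every $n$, the RB subalgebra $\mathcal R^{(n)}$ of $A^{(n)}$ generated by $X^1,\dots,X^n$ is a free weight-one RB algebra on the $n$ generators $X^1,\dots,X^n$. **Corollary.** Consider the monomials formed from symbols $Z_1,\dots,Z_n$ by iterating the associative product and a formal operator $T$, i.e. nonempty words whose letters are either some $Z_i$ or $T(m)$ with $m$ a monomial. Define elementary monomials inductively: they are the nonempty words in the $Z_i$, and the products $a_1T(b_1)a_2T(b_2)\cdots T(b_k)a_{k+1}$ with $k\ge1$, where the $b_j$ are elementary and the $a_j$ are words in the $Z_i$, nonempty for $2\le j\le k$ ($a_1$ and $a_{k+1}$ may be empty). Then the images of the elementary monomials under $Z_i\mapsto X^i$, $T\mapsto R$ (indexed by the elementary monomials, hence pairwise distinct) form a basis of the vector space $\mathcal R^{(n)}$; likewise, with a single symbol $Z\mapsto X$, they form a basis of $\mathcal R$. -/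

import Mathlib

universe u v w w'

namespace RB

section General

/-- The Rota–Baxter relation of weight `θ` for a linear operator `R` on an associative,
not necessarily unital nor commutative, algebra. -/
def IsRotaBaxter {K : Type u} [CommRing K] {A : Type w} [NonUnitalRing A] [Module K A]
    (θ : K) (R : A →ₗ[K] A) : Prop :=
  ∀ x y : A, R x * R y = R (R x * y + x * R y + θ • (x * y))

/-- `(F, R)`, with the family `g` of elements of `F`, is a free (associative, not necessarily
unital) Rota–Baxter algebra of weight `θ` on the generators `g i`: it is a Rota–Baxter algebra,
and for every Rota–Baxter algebra `(B, P)` of weight `θ` and every family `b` in `B` there is a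
unique morphism of Rota–Baxter algebras `F → B` sending `g i` to `b i`. -/
def IsFreeRotaBaxter {K : Type u} [CommRing K] {F : Type w} [NonUnitalRing F] [Module K F]
    {ι : Type w'} (θ : K) (R : F →ₗ[K] F) (g : ι → F) : Prop :=
  IsRotaBaxter θ R ∧
    ∀ (B : Type v) [NonUnitalRing B] [Module K B] [IsScalarTower K B B] [SMulCommClass K B B]
      (P : B →ₗ[K] B), IsRotaBaxter θ P → ∀ b : ι → B,
        ∃! φ : F →ₙₐ[K] B, (∀ x, φ (R x) = P (φ x)) ∧ ∀ i, φ (g i) = b i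

variable {K : Type u} [CommRing K] {A : Type w} [NonUnitalRing A] [Module K A]
  [IsScalarTower K A A] [SMulCommClass K A A] {ι : Type w'}

/-- The Rota–Baxter subalgebra of `(A, R)` generated by the family `g`: the smallest
subalgebra which contains every `g i` and is stable under `R`. -/
def subalg (R : A →ₗ[K] A) (g : ι → A) : NonUnitalSubalgebra K A :=
  sInf {S | (∀ i, g i ∈ S) ∧ ∀ x ∈ S, R x ∈ S}

theorem gen_mem_subalg (R : A →ₗ[K] A) (g : ι → A) (i : ι) : g i ∈ subalg R g := by
  unfold subalg
  rw [NonUnitalAlgebra.mem_sInf]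
  exact fun S hS => hS.1 i

theorem op_mem_subalg (R : A →ₗ[K] A) (g : ι → A) (x : A) (hx : x ∈ subalg R g) :
    R x ∈ subalg R g := by
  unfold subalg at hx ⊢
  rw [NonUnitalAlgebra.mem_sInf] at hx ⊢
  exact fun S hS => hS.2 x (hx S hS)

/-- The generators, as elements of the subalgebra they generate. -/
def subalgGen (R : A →ₗ[K] A) (g : ι → A) (i : ι) : subalg R g :=
  ⟨g i, gen_mem_subalg R g i⟩

/-- The restriction of `R` to the Rota–Baxter subalgebra generated by `g`. -/
def subalgOp (R : A →ₗ[K] A) (g : ι → A) : subalg R g →ₗ[K] subalg R g where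
  toFun x := ⟨R x, op_mem_subalg R g x x.2⟩
  map_add' x y := Subtype.ext (by simp)
  map_smul' c x := Subtype.ext (by simp)

end General

section Sequences

/-- `R (y₁, y₂, y₃, …) = (0, y₁, y₁ + y₂, …)` on sequences; the component of index `k : ℕ`
is the `(k + 1)`-st entry. -/
def partialSum (K : Type u) [CommRing K] (M : Type w) [AddCommMonoid M] [Module K M] :
    (ℕ → M) →ₗ[K] (ℕ → M) where
  toFun y k := ∑ i ∈ Finset.range k, y i
  map_add' y z := by funext k; simp [Finset.sum_add_distrib]
  map_smul' c y := by funext k; simp [Finset.smul_sum]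

/-- The algebra `A` of sequences in the free associative algebra on `x₁, x₂, …`, with pointwise
operations; the variable of index `k : ℕ` is `x_{k+1}`. -/
abbrev Seq (K : Type u) [CommRing K] : Type u := ℕ → FreeAlgebra K ℕ

/-- The alphabet `X = (x₁, x₂, …)`, viewed as an element of `A`; as a family with one member. -/
def seqX (K : Type u) [CommRing K] (_ : Unit) : Seq K := fun k => FreeAlgebra.ι K k

/-- The algebra `A⁽ⁿ⁾` of sequences in the free associative algebra on the disjoint union of `n`
alphabets; the variable of index `(i, k)` is the `(k + 1)`-st letter of the `i`-th alphabet. -/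
abbrev SeqN (K : Type u) [CommRing K] (n : ℕ) : Type u := ℕ → FreeAlgebra K (Fin n × ℕ)

/-- The alphabets `X¹, …, Xⁿ`, viewed as elements of `A⁽ⁿ⁾`. -/
def seqXN (K : Type u) [CommRing K] (n : ℕ) (i : Fin n) : SeqN K n :=
  fun k => FreeAlgebra.ι K (i, k)

end Sequences

section Monomials

/-- The monomials of the free associative algebra with a linear endomorphism `T` on generators
`Z i`: the symbols obtained from the generators by iterating `T` and the associative product.
Such a symbol is a nonempty word whose letters are `Z i` or `T m`, and it is listed here by its
first letter: `Z i`, `T m`, `Z i * m`, or `T m * m'`. -/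
inductive Mono (ι : Type w) : Type w
  | gen (i : ι) : Mono ι
  | op (m : Mono ι) : Mono ι
  | genMul (i : ι) (m : Mono ι) : Mono ι
  | opMul (m m' : Mono ι) : Mono ι

namespace Mono

variable {ι : Type w}

/-- The product of monomials: concatenation of words. -/
def mul : Mono ι → Mono ι → Mono ι
  | gen i, n => genMul i n
  | op m, n => opMul m n
  | genMul i m, n => genMul i (mul m n)
  | opMul m m', n => opMul m (mul m' n)

theorem mul_assoc' (a b c : Mono ι) : mul (mul a b) c = mul a (mul b c) := by
  induction a with
  | gen i => rfl
  | op m _ => rfl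
  | genMul i m ih => simp [mul, ih]
  | opMul m m' _ ih => simp [mul, ih]

/-- The first letter of the word is of the form `T m`. -/
def StartsWithOp : Mono ι → Prop
  | gen _ => False
  | op _ => True
  | genMul _ _ => False
  | opMul _ _ => True

/-- Elementary monomials: the words `a₁ T(b₁) a₂ T(b₂) ⋯ T(b_k) a_{k+1}`, `k ≥ 0`, where the
`b_j` are elementary, the `a_j` are words in the generators, and `a_2, …, a_k` are nonempty.
In other words, every letter `T b` has `b` elementary and is not followed by a letter `T b'`. -/
def IsElementary : Mono ι → Prop
  | gen _ => True
  | op b => IsElementary b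
  | genMul _ m => IsElementary m
  | opMul b m => IsElementary b ∧ IsElementary m ∧ ¬ StartsWithOp m

/-- The image of a monomial in an algebra with an operator `P`, when `Z i` is sent to `b i`. -/
def eval {B : Type v} [Mul B] (P : B → B) (b : ι → B) : Mono ι → B
  | gen i => b i
  | op m => P (eval P b m)
  | genMul i m => b i * eval P b m
  | opMul m m' => P (eval P b m) * eval P b m'

theorem eval_mul {B : Type v} [Semigroup B] (P : B → B) (b : ι → B) (m n : Mono ι) :
    eval P b (mul m n) = eval P b m * eval P b n := by
  induction m with
  | gen i => rfl
  | op m _ => rfl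
  | genMul i m ih => simp [mul, eval, ih, mul_assoc]
  | opMul m m' _ ih => simp [mul, eval, ih, mul_assoc]

end Mono

/-- The images of the elementary monomials, under `Z i ↦ g i` and `T ↦ R`, form a linear basis
of `F`. -/
def ElementaryBasis {K : Type u} [CommRing K] {F : Type w} [NonUnitalRing F] [Module K F]
    {ι : Type w'} (R : F →ₗ[K] F) (g : ι → F) : Prop :=
  ∃ e : Module.Basis {m : Mono ι // m.IsElementary} K F, ∀ m, e m = Mono.eval R g m.1

end Monomials

end RB

/-!
The space spanned by the elementary monomials is closed under the operator, and, in every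
Rota–Baxter algebra, under products: the Rota–Baxter relation rewrites each product of two
adjacent letters `T(c) T(d)` as `T` of a sum of products of smaller total size
(`RB.eval_mul_eval_mem`). Hence the elementary monomials span the Rota–Baxter subalgebra
generated by the given elements.

They are linearly independent in the algebra of sequences (`RB.linearIndependent_eval`). Give
each generator in a monomial its depth, the number of operators it lies under. Since `R` sums over
strictly smaller indices, in the entry of index `k` a generator of depth `d` contributes letters
with index at most `k - d`, and the word in which all these bounds are attained has coefficient
`1`. The sequence of generators and depths determines an elementary monomial
(`RB.Mono.depthWord_injOn`), so that these extremal words make the family triangular with respect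
to the total depth.

Freeness is then formal (`RB.ElementaryBasis.isFreeRotaBaxter`). The values of the elementary
monomials in a Rota–Baxter algebra `B` determine a linear map `φ` on the basis, whose graph is the
span of the elementary monomials in the Rota–Baxter algebra `F × B`. This span is closed under
products and the operator, so `φ` is a morphism.
-/

namespace RB

/-! ### Elementary monomials span -/

section Span

variable {K : Type u} [CommRing K] {A : Type w} [NonUnitalRing A] [Module K A] {ι : Type w'}

/-- The linear span of the values of the elementary monomials. -/
def elementarySpan (R : A →ₗ[K] A) (g : ι → A) : Submodule K A :=
  Submodule.span K {x | ∃ m : Mono ι, m.IsElementary ∧ m.eval R g = x}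

/-- The linear span of the values of the elementary monomials whose first letter is a
generator. A product `R y * z` with `y` in `elementarySpan R g` and `z` in this span needs no
rewriting by the Rota–Baxter relation: see `op_mul_mem_elementarySpan`. -/
def genSpan (R : A →ₗ[K] A) (g : ι → A) : Submodule K A :=
  Submodule.span K {x | ∃ m : Mono ι, m.IsElementary ∧ ¬ m.StartsWithOp ∧ m.eval R g = x}

variable {R : A →ₗ[K] A} {g : ι → A}

theorem eval_mem_elementarySpan {m : Mono ι} (hm : m.IsElementary) :
    m.eval R g ∈ elementarySpan R g :=
  Submodule.subset_span ⟨m, hm, rfl⟩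

theorem eval_mem_genSpan {m : Mono ι} (hm : m.IsElementary) (hs : ¬ m.StartsWithOp) :
    m.eval R g ∈ genSpan R g :=
  Submodule.subset_span ⟨m, hm, hs, rfl⟩

theorem genSpan_le : genSpan R g ≤ elementarySpan R g :=
  Submodule.span_mono fun _ ⟨m, hm, _, h⟩ => ⟨m, hm, h⟩

theorem op_mem_elementarySpan {x : A} (hx : x ∈ elementarySpan R g) :
    R x ∈ elementarySpan R g := by
  induction hx using Submodule.span_induction with
  | mem x hx =>
    obtain ⟨m, hm, rfl⟩ := hx
    exact eval_mem_elementarySpan (m := .op m) hm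
  | zero => simp
  | add x y _ _ hx hy => simpa using add_mem hx hy
  | smul c x _ hx => simpa using Submodule.smul_mem _ c hx

theorem gen_mul_mem_genSpan [SMulCommClass K A A] (i : ι) {x : A} (hx : x ∈ elementarySpan R g) :
    g i * x ∈ genSpan R g := by
  induction hx using Submodule.span_induction with
  | mem x hx =>
    obtain ⟨m, hm, rfl⟩ := hx
    exact eval_mem_genSpan (m := .genMul i m) hm id
  | zero => simp
  | add x y _ _ hx hy => simpa [mul_add] using add_mem hx hy
  | smul c x _ hx => simpa [mul_smul_comm] using Submodule.smul_mem _ c hx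

variable [IsScalarTower K A A] [SMulCommClass K A A]

theorem op_mul_mem_elementarySpan {x y : A} (hx : x ∈ elementarySpan R g)
    (hy : y ∈ genSpan R g) : R x * y ∈ elementarySpan R g := by
  induction hx, hy using Submodule.span_induction₂ with
  | mem_mem x y hx hy =>
    obtain ⟨m, hm, rfl⟩ := hx
    obtain ⟨n, hn, hs, rfl⟩ := hy
    exact eval_mem_elementarySpan (m := .opMul m n) ⟨hm, hn, hs⟩
  | zero_left => simp
  | zero_right => simp
  | add_left x y z _ _ _ hx hy => simpa [add_mul] using add_mem hx hy
  | add_right x y z _ _ _ hx hy => simpa [mul_add] using add_mem hx hy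
  | smul_left c x y _ _ h => simpa [smul_mul_assoc] using Submodule.smul_mem _ c h
  | smul_right c x y _ _ h => simpa [mul_smul_comm] using Submodule.smul_mem _ c h

/-- The product of two elementary monomials is a combination of elementary monomials, by
induction on the sum of their sizes: where a product `T(c) T(d)` of letters appears, the
Rota–Baxter relation replaces it by `T` of products of smaller total size. -/
theorem eval_mul_eval_mem {θ : K} (hR : IsRotaBaxter θ R) (m n : Mono ι)
    (hm : m.IsElementary) (hn : n.IsElementary) :
    m.eval R g * n.eval R g ∈ elementarySpan R g := by
  -- `R(c)R(d) = R(y)` with `y` in the span, given the products of smaller total size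
  have key (c d : Mono ι)
      (h₁ : R (c.eval R g) * d.eval R g ∈ elementarySpan R g)
      (h₂ : c.eval R g * R (d.eval R g) ∈ elementarySpan R g)
      (h₃ : c.eval R g * d.eval R g ∈ elementarySpan R g) :
      ∃ y ∈ elementarySpan R g, R (c.eval R g) * R (d.eval R g) = R y :=
    ⟨_, add_mem (add_mem h₁ h₂) (Submodule.smul_mem _ θ h₃), hR _ _⟩
  match m, hm with
  | .gen i, _ => exact genSpan_le (gen_mul_mem_genSpan i (eval_mem_elementarySpan hn))
  | .genMul i m, hm =>
    have h := eval_mul_eval_mem hR m n hm hn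
    simpa [Mono.eval, mul_assoc] using genSpan_le (gen_mul_mem_genSpan i h)
  | .opMul c m, ⟨hc, hm, hs⟩ =>
    -- `m` starts with a generator, hence so do the monomials of the product `m * n`
    have h : m.eval R g * n.eval R g ∈ genSpan R g := by
      match m, hm, hs with
      | .gen i, _, _ => exact gen_mul_mem_genSpan i (eval_mem_elementarySpan hn)
      | .genMul i m, hm, _ =>
        have h := eval_mul_eval_mem hR m n hm hn
        simpa [Mono.eval, mul_assoc] using gen_mul_mem_genSpan i h
      | .op _, _, hs => exact absurd trivial hs
      | .opMul _ _, _, hs => exact absurd trivial hs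
    simpa [Mono.eval, mul_assoc] using op_mul_mem_elementarySpan (eval_mem_elementarySpan hc) h
  | .op c, hc =>
    match n, hn with
    | .gen i, hn => exact eval_mem_elementarySpan (m := .opMul c (.gen i)) ⟨hc, hn, id⟩
    | .genMul i n, hn => exact eval_mem_elementarySpan (m := .opMul c (.genMul i n)) ⟨hc, hn, id⟩
    | .op d, hd =>
      obtain ⟨y, hy, h⟩ := key c d (eval_mul_eval_mem hR (.op c) d hc hd)
        (eval_mul_eval_mem hR c (.op d) hc hd) (eval_mul_eval_mem hR c d hc hd)
      simpa [Mono.eval, h] using op_mem_elementarySpan hy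
    | .opMul d n, ⟨hd, hn, hs⟩ =>
      obtain ⟨y, hy, h⟩ := key c d (eval_mul_eval_mem hR (.op c) d hc hd)
        (eval_mul_eval_mem hR c (.op d) hc hd) (eval_mul_eval_mem hR c d hc hd)
      simpa [Mono.eval, ← mul_assoc, h] using
        op_mul_mem_elementarySpan hy (eval_mem_genSpan hn hs)
termination_by sizeOf m + sizeOf n

theorem mul_mem_elementarySpan {θ : K} (hR : IsRotaBaxter θ R) {x y : A}
    (hx : x ∈ elementarySpan R g) (hy : y ∈ elementarySpan R g) :
    x * y ∈ elementarySpan R g := by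
  induction hx, hy using Submodule.span_induction₂ with
  | mem_mem x y hx hy =>
    obtain ⟨m, hm, rfl⟩ := hx
    obtain ⟨n, hn, rfl⟩ := hy
    exact eval_mul_eval_mem hR m n hm hn
  | zero_left => simp
  | zero_right => simp
  | add_left x y z _ _ _ hx hy => simpa [add_mul] using add_mem hx hy
  | add_right x y z _ _ _ hx hy => simpa [mul_add] using add_mem hx hy
  | smul_left c x y _ _ h => simpa [smul_mul_assoc] using Submodule.smul_mem _ c h
  | smul_right c x y _ _ h => simpa [mul_smul_comm] using Submodule.smul_mem _ c h

theorem subalg_le_elementarySpan {θ : K} (hR : IsRotaBaxter θ R) {x : A}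
    (hx : x ∈ subalg R g) : x ∈ elementarySpan R g := by
  unfold subalg at hx
  rw [NonUnitalAlgebra.mem_sInf] at hx
  exact hx { elementarySpan R g with mul_mem' := mul_mem_elementarySpan hR }
    ⟨fun i => eval_mem_elementarySpan (m := .gen i) trivial, fun _ => op_mem_elementarySpan⟩

theorem IsRotaBaxter.subalgOp {θ : K} (hR : IsRotaBaxter θ R) (g : ι → A) :
    IsRotaBaxter θ (subalgOp R g) :=
  fun x y => Subtype.ext (hR x y)

theorem coe_eval_subalg (R : A →ₗ[K] A) (g : ι → A) (m : Mono ι) :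
    ((m.eval (subalgOp R g) (subalgGen R g) : subalg R g) : A) = m.eval R g := by
  induction m with
  | gen i => rfl
  | op m ih => exact congrArg R ih
  | genMul i m ih => exact congrArg (g i * ·) ih
  | opMul m n ihm ihn => exact congrArg₂ (R · * ·) ihm ihn

theorem elementaryBasis_subalg {θ : K} (hR : IsRotaBaxter θ R)
    (h : LinearIndependent K fun m : {m : Mono ι // m.IsElementary} => m.1.eval R g) :
    ElementaryBasis (subalgOp R g) (subalgGen R g) := by
  let ev : {m : Mono ι // m.IsElementary} → subalg R g :=
    fun m => m.1.eval (subalgOp R g) (subalgGen R g)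
  let incl : subalg R g →ₗ[K] A := (subalg R g).toSubmodule.subtype
  have hev : (incl ∘ ev) = fun m => m.1.eval R g := funext fun m => coe_eval_subalg R g m.1
  have hli : LinearIndependent K ev := LinearIndependent.of_comp incl (hev ▸ h)
  have hspan : ⊤ ≤ Submodule.span K (Set.range ev) := fun x _ => by
    have hx : incl x ∈ (Submodule.span K (Set.range ev)).map incl := by
      rw [Submodule.map_span, ← Set.range_comp, hev]
      have hset : (Set.range fun m : {m : Mono ι // m.IsElementary} => m.1.eval R g) =
          {x | ∃ m : Mono ι, m.IsElementary ∧ m.eval R g = x} := by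
        ext y
        simp
      rw [hset]
      exact subalg_le_elementarySpan hR x.2
    obtain ⟨y, hy, hyx⟩ := hx
    rwa [← Subtype.ext (a1 := y) (a2 := x) hyx]
  exact ⟨Module.Basis.mk hli hspan, fun m => by simp [ev]⟩

end Span

/-! ### An elementary basis gives freeness -/

section Free

variable {K : Type u} [CommRing K] {A : Type w} [NonUnitalRing A] [Module K A] {ι : Type w'}

theorem map_eval {B : Type v} [NonUnitalRing B] [Module K B] {R : A →ₗ[K] A} {P : B →ₗ[K] B}
    {g : ι → A} {b : ι → B} (φ : A →ₙₐ[K] B) (hφ : ∀ x, φ (R x) = P (φ x))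
    (hg : ∀ i, φ (g i) = b i) (m : Mono ι) : φ (m.eval R g) = m.eval P b := by
  induction m with
  | gen i => exact hg i
  | op m ih => simp [Mono.eval, hφ, ih]
  | genMul i m ih => simp [Mono.eval, hg, ih]
  | opMul m n ihm ihn => simp [Mono.eval, hφ, ihm, ihn]

theorem eval_prod {B : Type v} [NonUnitalRing B] [Module K B] (R : A →ₗ[K] A) (P : B →ₗ[K] B)
    (g : ι → A) (b : ι → B) (m : Mono ι) :
    m.eval (R.prodMap P) (fun i => (g i, b i)) = (m.eval R g, m.eval P b) := by
  induction m with
  | gen i => rfl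
  | op m ih => simp [Mono.eval, ih]
  | genMul i m ih => simp [Mono.eval, ih]
  | opMul m n ihm ihn => simp [Mono.eval, ihm, ihn]

/-- If the elementary monomials form a basis, then the linear map `φ` determined by their values
in `(B, P)` is multiplicative: the graph of `φ` is the span of the elementary monomials in the
Rota–Baxter algebra `A × B`, and such a span is closed under products. -/
theorem ElementaryBasis.isFreeRotaBaxter [IsScalarTower K A A] [SMulCommClass K A A] {θ : K}
    {R : A →ₗ[K] A} {g : ι → A} (hR : IsRotaBaxter θ R) (h : ElementaryBasis R g) :
    IsFreeRotaBaxter.{u, v} θ R g := by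
  obtain ⟨e, he⟩ := h
  refine ⟨hR, fun B _ _ _ _ P hP b => ?_⟩
  let φ : A →ₗ[K] B := e.constr K fun m => m.1.eval P b
  have hφ (m : Mono ι) (hm : m.IsElementary) : φ (m.eval R g) = m.eval P b := by
    rw [← he ⟨m, hm⟩, Module.Basis.constr_basis]
  have hRP : IsRotaBaxter θ (R.prodMap P) :=
    fun x y => Prod.ext (hR x.1 y.1) (hP x.2 y.2)
  let S := elementarySpan (R.prodMap P) (fun i => (g i, b i))
  have hS {z : A × B} (hz : z ∈ S) : z.2 = φ z.1 := by
    induction hz using Submodule.span_induction with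
    | mem z hz =>
      obtain ⟨m, hm, rfl⟩ := hz
      simp [eval_prod, hφ m hm]
    | zero => simp
    | add x y _ _ hx hy => simp [hx, hy]
    | smul c x _ hx => simp [hx]
  have hgraph (x : A) : (x, φ x) ∈ S := by
    induction e.mem_span x using Submodule.span_induction with
    | mem x hx =>
      obtain ⟨m, rfl⟩ := hx
      rw [he, hφ _ m.2, ← eval_prod]
      exact eval_mem_elementarySpan m.2
    | zero =>
      rw [map_zero]
      exact S.zero_mem
    | add x y _ _ hx hy => simpa using add_mem hx hy
    | smul c x _ hx => simpa using Submodule.smul_mem _ c hx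
  let ψ : A →ₙₐ[K] B :=
    { φ with
      map_zero' := φ.map_zero
      map_mul' := fun x y => (hS (mul_mem_elementarySpan hRP (hgraph x) (hgraph y))).symm }
  refine ⟨ψ, ⟨fun x => (hS (op_mem_elementarySpan (hgraph x))).symm,
    fun i => hφ (.gen i) trivial⟩, fun χ ⟨hχ, hχg⟩ => ?_⟩
  have hlin : (χ : A →ₗ[K] B) = φ := e.ext fun m => by
    rw [he, hφ _ m.2]
    exact map_eval χ hχ hχg m.1
  exact NonUnitalAlgHom.ext fun x => LinearMap.congr_fun hlin x

end Free

/-! ### Depth words of elementary monomials -/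

namespace Mono

variable {ι : Type w}

/-- The word of all occurrences of generators in a monomial, read from left to right, each with
its depth, the number of operators `T` it lies under. -/
def depthWord : Mono ι → List (ι × ℕ)
  | gen i => [(i, 0)]
  | op m => m.depthWord.map (Prod.map id Nat.succ)
  | genMul i m => (i, 0) :: m.depthWord
  | opMul m n => m.depthWord.map (Prod.map id Nat.succ) ++ n.depthWord

theorem depthWord_ne_nil (m : Mono ι) : m.depthWord ≠ [] := by
  induction m <;> simp_all [depthWord]

theorem depthWord_eq_zero_cons {m : Mono ι} (h : ¬ m.StartsWithOp) :
    ∃ i l, m.depthWord = (i, 0) :: l := by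
  cases m <;> simp_all [depthWord, StartsWithOp]

theorem map_id_succ_injective : Function.Injective (Prod.map (id : ι → ι) Nat.succ) :=
  Function.injective_id.prodMap Nat.succ_injective

theorem map_succ_append_cons_inj {a b l l' : List (ι × ℕ)} {i j : ι}
    (h : a.map (Prod.map id Nat.succ) ++ (i, 0) :: l =
      b.map (Prod.map id Nat.succ) ++ (j, 0) :: l') :
    a = b ∧ (i, 0) :: l = (j, 0) :: l' := by
  induction a generalizing b with
  | nil => cases b <;> simp_all [Prod.ext_iff]
  | cons p a ih =>
    cases b with
    | nil => simp_all [Prod.ext_iff]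
    | cons q b =>
      simp only [List.map_cons, List.cons_append, List.cons.injEq] at h
      obtain ⟨hab, hl⟩ := ih h.2
      exact ⟨by rw [map_id_succ_injective h.1, hab], hl⟩

theorem map_succ_append_cons_ne (a b l : List (ι × ℕ)) (i : ι) :
    a.map (Prod.map id Nat.succ) ++ (i, 0) :: l ≠ b.map (Prod.map id Nat.succ) := by
  intro h
  have : (i, 0) ∈ b.map (Prod.map id Nat.succ) := h ▸ by simp
  simp at this

theorem map_succ_ne_zero_cons (m : Mono ι) (t l : List (ι × ℕ)) (i : ι) :
    m.depthWord.map (Prod.map id Nat.succ) ++ t ≠ (i, 0) :: l := by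
  obtain ⟨p, s, hp⟩ := List.exists_cons_of_ne_nil m.depthWord_ne_nil
  simp [hp, Prod.ext_iff]

/-- An elementary monomial is determined by its depth word: the letters of depth `0` are its
top-level generators, and each maximal block of letters of positive depth between them comes
from exactly one letter `T b`, since no two such letters are adjacent. -/
theorem depthWord_injOn {m n : Mono ι} (hm : m.IsElementary) (hn : n.IsElementary)
    (h : m.depthWord = n.depthWord) : m = n := by
  have hsucc : Function.Injective (List.map (Prod.map (id : ι → ι) Nat.succ)) :=
    List.map_injective_iff.2 map_id_succ_injective
  have hne (c : Mono ι) (l i) : c.depthWord.map (Prod.map id Nat.succ) ≠ (i, 0) :: l := by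
    simpa using map_succ_ne_zero_cons c [] l i
  induction m generalizing n with
  | gen i =>
    cases n with
    | gen j => simp_all [depthWord]
    | op d => exact absurd h.symm (hne d _ i)
    | genMul j n =>
      simp only [depthWord, List.cons.injEq] at h
      exact absurd h.2.symm n.depthWord_ne_nil
    | opMul d n => exact absurd h.symm (map_succ_ne_zero_cons d _ _ i)
  | op c ih =>
    cases n with
    | gen j => exact absurd h (hne c _ j)
    | op d => rw [ih (n := d) hm hn (hsucc h)]
    | genMul j n => exact absurd h (hne c _ j)
    | opMul d n =>
      obtain ⟨j, l, hl⟩ := depthWord_eq_zero_cons hn.2.2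
      exact absurd (by simpa [depthWord, hl] using h.symm) (map_succ_append_cons_ne _ _ l j)
  | genMul i m ih =>
    cases n with
    | gen j =>
      simp only [depthWord, List.cons.injEq] at h
      exact absurd h.2 m.depthWord_ne_nil
    | op d => exact absurd h.symm (hne d _ i)
    | genMul j n =>
      simp only [depthWord, List.cons.injEq, Prod.mk.injEq, and_true] at h
      rw [h.1, ih (n := n) hm hn h.2]
    | opMul d n => exact absurd h.symm (map_succ_ne_zero_cons d _ _ i)
  | opMul c m ihc ihm =>
    obtain ⟨i, l, hl⟩ := depthWord_eq_zero_cons hm.2.2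
    cases n with
    | gen j => exact absurd h (map_succ_ne_zero_cons c _ _ j)
    | op d => exact absurd (by simpa [depthWord, hl] using h) (map_succ_append_cons_ne _ _ l i)
    | genMul j n => exact absurd h (map_succ_ne_zero_cons c _ _ j)
    | opMul d n =>
      obtain ⟨j, l', hl'⟩ := depthWord_eq_zero_cons hn.2.2
      simp only [depthWord, hl, hl'] at h
      obtain ⟨hcd, hmn⟩ := map_succ_append_cons_inj h
      rw [ihc hm.1 hn.1 hcd, ihm hm.2.1 hn.2.1 (by rw [hl, hl', hmn])]

end Mono

/-! ### Coefficients of words in the free algebra -/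

section WordCoeff

variable (K : Type u) [CommRing K] {V : Type w}

/-- The coefficient of a word in an element of the free associative algebra. -/
noncomputable def wordCoeff (w : List V) : FreeAlgebra K V →ₗ[K] K where
  toFun f := (FreeAlgebra.equivMonoidAlgebraFreeMonoid f).coeff (FreeMonoid.ofList w)
  map_add' f g := by simp
  map_smul' c f := by simp

variable {K}

open Classical in
theorem wordCoeff_ι (w : List V) (x : V) :
    wordCoeff K w (FreeAlgebra.ι K x) = if w = [x] then 1 else 0 := by
  have : FreeMonoid.of x = FreeMonoid.ofList w ↔ w = [x] := by
    rw [← FreeMonoid.ofList_singleton, FreeMonoid.ofList.apply_eq_iff_eq, eq_comm]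
  simp [wordCoeff, FreeAlgebra.equivMonoidAlgebraFreeMonoid, Finsupp.single_apply, this]

theorem exists_append_of_wordCoeff_mul_ne_zero {f g : FreeAlgebra K V} {w : List V}
    (h : wordCoeff K w (f * g) ≠ 0) :
    ∃ s t, w = s ++ t ∧ wordCoeff K s f ≠ 0 ∧ wordCoeff K t g ≠ 0 := by
  classical
  simp only [wordCoeff, LinearMap.coe_mk, AddHom.coe_mk, map_mul] at h
  have := MonoidAlgebra.support_coeff_mul_subset _ _ (Finsupp.mem_support_iff.2 h)
  obtain ⟨s, hs, t, ht, hst⟩ := Finset.mem_mul.1 this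
  exact ⟨s.toList, t.toList, congrArg FreeMonoid.toList hst.symm,
    Finsupp.mem_support_iff.1 hs, Finsupp.mem_support_iff.1 ht⟩

theorem wordCoeff_append_mul {f : FreeAlgebra K V} (g : FreeAlgebra K V) {s : List V}
    (t : List V) (hf : ∀ w, wordCoeff K w f ≠ 0 → w.length = s.length) :
    wordCoeff K (s ++ t) (f * g) = wordCoeff K s f * wordCoeff K t g := by
  simp only [wordCoeff, LinearMap.coe_mk, AddHom.coe_mk, map_mul, FreeMonoid.ofList_append]
  refine MonoidAlgebra.coeff_mul_mul_of_uniqueMul fun a b ha _ hab => ?_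
  exact List.append_inj (congrArg FreeMonoid.toList hab)
    (hf a.toList (Finsupp.mem_support_iff.1 ha))

end WordCoeff

/-! ### Independence of the elementary monomials -/

section Independence

variable {K : Type u} [CommRing K] {V : Type w} {ι : Type w'}

theorem partialSum_apply {M : Type w} [AddCommMonoid M] [Module K M] (y : ℕ → M) (k : ℕ) :
    partialSum K M y k = ∑ i ∈ Finset.range k, y i :=
  rfl

theorem isRotaBaxter_partialSum (M : Type w) [Ring M] [Algebra K M] :
    IsRotaBaxter (1 : K) (partialSum K M) := by
  intro x y
  funext k
  change (∑ i ∈ Finset.range k, x i) * ∑ i ∈ Finset.range k, y i =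
    ∑ i ∈ Finset.range k, ((∑ j ∈ Finset.range i, x j) * y i +
      x i * ∑ j ∈ Finset.range i, y j + (1 : K) • (x i * y i))
  induction k with
  | zero => simp
  | succ k ih =>
    rw [Finset.sum_range_succ x, Finset.sum_range_succ y, Finset.sum_range_succ, ← ih, one_smul,
      add_mul, mul_add, mul_add]
    abel

/-- The sequence attached to each generator by a doubly indexed family `v` of letters: the
entry of index `k` of the sequence `varSeq K v i` is the letter `v (i, k)`. -/
noncomputable def varSeq (K : Type u) [CommRing K] (v : ι × ℕ → V) (i : ι) : ℕ → FreeAlgebra K V :=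
  fun k => FreeAlgebra.ι K (v (i, k))

/-- The words that occur in the `k`-th entry of a monomial with depth word `d` consist of the
generators of `d`, in the same order, a generator of depth `q` having an index at most `k - q`. -/
theorem forall₂_of_wordCoeff_eval_ne_zero (v : ι × ℕ → V) (m : Mono ι) (k : ℕ) (w : List V)
    (h : wordCoeff K w (m.eval (partialSum K _) (varSeq K v) k) ≠ 0) :
    List.Forall₂ (fun x q => ∃ a, x = v (q.1, a) ∧ a + q.2 ≤ k) w m.depthWord := by
  classical
  -- the effect of the operator, common to a letter `T m` at the end and elsewhere in a word
  have hop (m : Mono ι) (ih : ∀ k w,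
      wordCoeff K w (m.eval (partialSum K _) (varSeq K v) k) ≠ 0 →
        List.Forall₂ (fun x q => ∃ a, x = v (q.1, a) ∧ a + q.2 ≤ k) w m.depthWord)
      (k : ℕ) (w : List V)
      (h : wordCoeff K w (partialSum K _ (m.eval (partialSum K _) (varSeq K v)) k) ≠ 0) :
      List.Forall₂ (fun x q => ∃ a, x = v (q.1, a) ∧ a + q.2 ≤ k) w
        (m.depthWord.map (Prod.map id Nat.succ)) := by
    rw [partialSum_apply, map_sum] at h
    obtain ⟨j, hj, hne⟩ := Finset.exists_ne_zero_of_sum_ne_zero h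
    rw [List.forall₂_map_right_iff]
    refine (ih j w hne).imp fun x q ⟨a, hx, ha⟩ => ⟨a, hx, ?_⟩
    have := Finset.mem_range.1 hj
    simp only [Prod.map_snd]
    omega
  have hgen (i : ι) (k : ℕ) (w : List V) (h : wordCoeff K w (varSeq K v i k) ≠ 0) :
      w = [v (i, k)] := by
    rw [varSeq, wordCoeff_ι] at h
    by_contra hw
    exact h (if_neg hw)
  induction m generalizing k w with
  | gen i =>
    rw [hgen i k w h]
    exact .cons ⟨k, rfl, le_rfl⟩ .nil
  | op m ih => exact hop m ih k w h
  | genMul i m ih =>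
    obtain ⟨s, t, rfl, hs, ht⟩ := exists_append_of_wordCoeff_mul_ne_zero h
    rw [hgen i k s hs]
    exact .cons ⟨k, rfl, le_rfl⟩ (ih k t ht)
  | opMul m n ihm ihn =>
    obtain ⟨s, t, rfl, hs, ht⟩ := exists_append_of_wordCoeff_mul_ne_zero h
    exact List.rel_append (hop m ihm k s hs) (ihn k t ht)

/-- The word in which every index is the largest one that its depth allows has coefficient `1`:
in each sum over `j < k`, only `j = k - 1` contributes to it. -/
theorem wordCoeff_eval_eq_one {v : ι × ℕ → V} (hv : Function.Injective v) (m : Mono ι) (k : ℕ)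
    (w : List V)
    (h : List.Forall₂ (fun x q => ∃ a, x = v (q.1, a) ∧ a + q.2 = k) w m.depthWord) :
    wordCoeff K w (m.eval (partialSum K _) (varSeq K v) k) = 1 := by
  classical
  -- the effect of the operator, common to a letter `T m` at the end and elsewhere in a word
  have hop (m : Mono ι) (ih : ∀ k w,
      List.Forall₂ (fun x q => ∃ a, x = v (q.1, a) ∧ a + q.2 = k) w m.depthWord →
        wordCoeff K w (m.eval (partialSum K _) (varSeq K v) k) = 1)
      (k : ℕ) (w : List V)
      (h : List.Forall₂ (fun x q => ∃ a, x = v (q.1, a) ∧ a + q.2 = k) w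
        (m.depthWord.map (Prod.map id Nat.succ))) :
      wordCoeff K w (partialSum K _ (m.eval (partialSum K _) (varSeq K v)) k) = 1 := by
    rw [List.forall₂_map_right_iff] at h
    have hzero (j : ℕ) (hj : j + 1 < k) :
        wordCoeff K w (m.eval (partialSum K _) (varSeq K v) j) = 0 := by
      by_contra hne
      have hle := forall₂_of_wordCoeff_eval_ne_zero v m j w hne
      obtain ⟨q, l, hq⟩ := List.exists_cons_of_ne_nil m.depthWord_ne_nil
      rw [hq] at h hle
      obtain _ | ⟨⟨a, rfl, ha⟩, _⟩ := h
      obtain _ | ⟨⟨b, hb, hbj⟩, _⟩ := hle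
      have := hv hb
      simp_all
      omega
    obtain ⟨q, l, hq⟩ := List.exists_cons_of_ne_nil m.depthWord_ne_nil
    cases k with
    | zero =>
      rw [hq] at h
      obtain _ | ⟨⟨a, _, ha⟩, _⟩ := h
      simp at ha
    | succ k =>
      rw [partialSum_apply, map_sum, Finset.sum_range_succ,
        Finset.sum_eq_zero fun j hj => hzero j (by simpa using hj), zero_add]
      exact ih k w (h.imp fun x q ⟨a, hx, ha⟩ => ⟨a, hx, by simpa [← add_assoc] using ha⟩)
  induction m generalizing k w with
  | gen i =>
    obtain _ | ⟨⟨a, rfl, rfl⟩, h'⟩ := h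
    cases h'
    simp [Mono.eval, varSeq, wordCoeff_ι]
  | op m ih => exact hop m ih k w h
  | genMul i m ih =>
    obtain _ | ⟨⟨a, rfl, rfl⟩, h'⟩ := h
    refine (wordCoeff_append_mul (s := [v (i, a)]) _ _ fun w' hw' => ?_).trans ?_
    · rw [varSeq, wordCoeff_ι] at hw'
      by_contra hne
      exact hw' (if_neg fun hw => hne (by simp [hw]))
    · rw [varSeq, wordCoeff_ι, if_pos (by simp), one_mul]
      exact ih _ _ h'
  | opMul m n ihm ihn =>
    obtain ⟨s, t, rfl, hs, ht⟩ : ∃ s t, w = s ++ t ∧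
        List.Forall₂ (fun x q => ∃ a, x = v (q.1, a) ∧ a + q.2 = k) s
          (m.depthWord.map (Prod.map id Nat.succ)) ∧
        List.Forall₂ (fun x q => ∃ a, x = v (q.1, a) ∧ a + q.2 = k) t n.depthWord :=
      ⟨_, _, (List.take_append_drop _ w).symm, List.forall₂_take_append _ _ _ h,
        List.forall₂_drop_append _ _ _ h⟩
    refine (wordCoeff_append_mul _ _ fun w' hw' => ?_).trans ?_
    · exact (forall₂_of_wordCoeff_eval_ne_zero v (.op m) k w' hw').length_eq.trans
        hs.length_eq.symm
    · rw [hop m ihm k s hs, ihn k t ht, one_mul]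

/-- If the word with the largest indices allowed by the depths in `d₀` respects the bounds given
by `d`, then `d` has the same letters as `d₀` with smaller or equal depths. -/
theorem sum_depth_le_of_forall₂ {v : ι × ℕ → V} (hv : Function.Injective v) {k : ℕ}
    {d₀ d : List (ι × ℕ)} (hk : ∀ q ∈ d₀, q.2 ≤ k)
    (h : List.Forall₂ (fun x q => ∃ a, x = v (q.1, a) ∧ a + q.2 ≤ k)
      (d₀.map fun q => v (q.1, k - q.2)) d) :
    (d.map Prod.snd).sum ≤ (d₀.map Prod.snd).sum ∧
      ((d₀.map Prod.snd).sum ≤ (d.map Prod.snd).sum → d₀ = d) := by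
  induction d₀ generalizing d with
  | nil =>
    cases h
    simp
  | cons p d₀ ih =>
    obtain _ | ⟨⟨a, hx, ha⟩, h'⟩ := h
    obtain ⟨hle, heq⟩ := ih (fun q hq => hk q (List.mem_cons_of_mem _ hq)) h'
    have hp := hk p List.mem_cons_self
    obtain ⟨h₁, h₂⟩ := Prod.mk.inj (hv hx)
    simp only [List.map_cons, List.sum_cons]
    refine ⟨by omega, fun hs => ?_⟩
    rw [heq (by omega), Prod.ext h₁ (by omega)]

/-- In a vanishing linear combination, take a monomial `m₀` of least total depth. In the entry
of a large index `k`, its extremal word occurs with coefficient `1`, and in no other monomial of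
the combination. -/
theorem linearIndependent_eval {v : ι × ℕ → V} (hv : Function.Injective v) :
    LinearIndependent K fun m : {m : Mono ι // m.IsElementary} =>
      m.1.eval (partialSum K (FreeAlgebra K V)) (varSeq K v) := by
  rw [linearIndependent_iff]
  intro l hl
  by_contra hne
  obtain ⟨m₀, hm₀, hmin⟩ := l.support.exists_min_image
    (fun m => (m.1.depthWord.map Prod.snd).sum) (Finsupp.support_nonempty_iff.2 hne)
  let k := (m₀.1.depthWord.map Prod.snd).sum
  have hk : ∀ q ∈ m₀.1.depthWord, q.2 ≤ k := fun q hq =>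
    List.single_le_sum (by simp) _ (List.mem_map_of_mem hq)
  let w := m₀.1.depthWord.map fun q => v (q.1, k - q.2)
  have hone : wordCoeff K w (m₀.1.eval (partialSum K _) (varSeq K v) k) = 1 := by
    refine wordCoeff_eval_eq_one hv _ _ _ ?_
    rw [List.forall₂_map_left_iff, List.forall₂_same]
    exact fun q hq => ⟨k - q.2, rfl, Nat.sub_add_cancel (hk q hq)⟩
  have hzero (m) (hm : m ∈ l.support) (hmm : m ≠ m₀) :
      wordCoeff K w (m.1.eval (partialSum K _) (varSeq K v) k) = 0 := by
    by_contra h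
    have := (sum_depth_le_of_forall₂ hv hk
      (forall₂_of_wordCoeff_eval_ne_zero v m.1 k w h)).2 (hmin m hm)
    exact hmm (Subtype.ext (Mono.depthWord_injOn m₀.2 m.2 this).symm)
  have := congrArg (wordCoeff K w) (congrFun hl k)
  rw [Finsupp.linearCombination_apply, Finsupp.sum, Finset.sum_apply, map_sum,
    Finset.sum_eq_single_of_mem m₀ hm₀ fun m hm hmm => by simp [hzero m hm hmm]] at this
  exact Finsupp.mem_support_iff.1 hm₀ (by simpa [hone] using this)

theorem isFreeRotaBaxter_and_elementaryBasis {v : ι × ℕ → V} (hv : Function.Injective v) :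
    IsFreeRotaBaxter.{u, v} (1 : K) (subalgOp (partialSum K (FreeAlgebra K V)) (varSeq K v))
        (subalgGen (partialSum K (FreeAlgebra K V)) (varSeq K v)) ∧
      ElementaryBasis (subalgOp (partialSum K (FreeAlgebra K V)) (varSeq K v))
        (subalgGen (partialSum K (FreeAlgebra K V)) (varSeq K v)) :=
  have hR := isRotaBaxter_partialSum (K := K) (FreeAlgebra K V)
  have hb := elementaryBasis_subalg hR (linearIndependent_eval hv)
  ⟨hb.isFreeRotaBaxter (hR.subalgOp _), hb⟩

end Independence

end RB

theorem mainTheorem6 (K : Type u) [Field K] [CharZero K] :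
    (RB.IsFreeRotaBaxter.{u, v} (1 : K)
        (RB.subalgOp (RB.partialSum K (FreeAlgebra K ℕ)) (RB.seqX K))
        (RB.subalgGen (RB.partialSum K (FreeAlgebra K ℕ)) (RB.seqX K)) ∧
      RB.ElementaryBasis
        (RB.subalgOp (RB.partialSum K (FreeAlgebra K ℕ)) (RB.seqX K))
        (RB.subalgGen (RB.partialSum K (FreeAlgebra K ℕ)) (RB.seqX K))) ∧
    ∀ n : ℕ,
      RB.IsFreeRotaBaxter.{u, v} (1 : K)
        (RB.subalgOp (RB.partialSum K (FreeAlgebra K (Fin n × ℕ))) (RB.seqXN K n))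
        (RB.subalgGen (RB.partialSum K (FreeAlgebra K (Fin n × ℕ))) (RB.seqXN K n)) ∧
      RB.ElementaryBasis
        (RB.subalgOp (RB.partialSum K (FreeAlgebra K (Fin n × ℕ))) (RB.seqXN K n))
        (RB.subalgGen (RB.partialSum K (FreeAlgebra K (Fin n × ℕ))) (RB.seqXN K n)) := by
  refine ⟨?_, fun n => ?_⟩
  -- both cases have the same form, with letters indexed by `Unit × ℕ` and by `Fin n × ℕ`
  · rw [show RB.seqX K = RB.varSeq K fun p : Unit × ℕ => p.2 from rfl]
    exact RB.isFreeRotaBaxter_and_elementaryBasis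
      fun _ _ h => Prod.ext rfl h
  · rw [show RB.seqXN K n = RB.varSeq K id from rfl]
    exact RB.isFreeRotaBaxter_and_elementaryBasis Function.injective_id
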